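/- Let $P$ be a finite non-empty poset. A \emph{partial linear extension} (ple) of $P$ is a linear extension of a (non-empty, induced) subposet of $P$. A \emph{local realizer} of $P$ is a non-empty family $\mathcal{L}$ of ple's of $P$ such that (i) if $x<y$ in $P$, then $x<y$ in some $L\in\mathcal{L}$, and (ii) if $x$ and $y$ are incomparable in $P$, then there are $L,L'\in\mathcal{L}$ with $x<y$ in $L$ and $x>y$ in $L'$. The \emph{local dimension} $\operatorname{ldim}(P)$ is the minimum, over all local realizers $\mathcal{L}$ of $P$, of the maximum over $x\in P$ of the number of members of $\mathcal{L}$ that contain $x$. For $n\ge 1$ let $f(n)$ be the maximum of $\operatorname{ldim}(P)$ over all posets $P$ on $n$ points. Then $$f(n)=\Theta\!\left(\frac{n}{\log n}\right)\qquad (n\to\infty),$$ and moreover $f(n)\le (1+o(1))\,\dfrac{4n}{\log_2(2n)}$. -/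

import Mathlib

open Filter Topology Asymptotics

namespace LocalDim

/-- A partial linear extension of a poset `P`: a linear order on a non-empty subset `carrier` of `P`
that extends the order which `P` induces on that subset. The order is stored as a relation on `P`
that holds between elements of `carrier` only, so that a partial linear extension is determined by
its ground set and its order. -/
structure PartialLinearExtension (P : Type*) [PartialOrder P] where
  /-- the ground set -/
  carrier : Set P
  nonempty : carrier.Nonempty
  /-- the (reflexive) linear order on the ground set -/
  le : P → P → Prop
  mem_of_le : ∀ x y, le x y → x ∈ carrier ∧ y ∈ carrier
  antisymm : ∀ x y, le x y → le y x → x = y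
  trans : ∀ x y z, le x y → le y z → le x z
  total : ∀ x ∈ carrier, ∀ y ∈ carrier, le x y ∨ le y x
  extends_le : ∀ x ∈ carrier, ∀ y ∈ carrier, x ≤ y → le x y

/-- `x < y` in `L`. -/
def PartialLinearExtension.lt {P : Type*} [PartialOrder P] (L : PartialLinearExtension P)
    (x y : P) : Prop :=
  L.le x y ∧ x ≠ y

/-- A local realizer of `P`. -/
structure IsLocalRealizer {P : Type*} [PartialOrder P] (F : Set (PartialLinearExtension P)) :
    Prop where
  nonempty : F.Nonempty
  exists_of_lt : ∀ x y : P, x < y → ∃ L ∈ F, L.lt x y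
  exists_of_incomp : ∀ x y : P, ¬ x ≤ y → ¬ y ≤ x → (∃ L ∈ F, L.lt x y) ∧ ∃ L ∈ F, L.lt y x

/-- The number of members of `F` that contain `x`. -/
noncomputable def frequency {P : Type*} [PartialOrder P] (x : P)
    (F : Set (PartialLinearExtension P)) : ℕ∞ :=
  {L | L ∈ F ∧ x ∈ L.carrier}.encard

/-- The maximum frequency of an element of `P` in `F`. -/
noncomputable def maxFrequency {P : Type*} [PartialOrder P]
    (F : Set (PartialLinearExtension P)) : ℕ∞ :=
  ⨆ x : P, frequency x F

/-- The local dimension of `P`: the minimum of the maximum frequency over all local realizers. -/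
noncomputable def localDim (P : Type*) [PartialOrder P] : ℕ∞ :=
  ⨅ F : {F : Set (PartialLinearExtension P) // IsLocalRealizer F}, maxFrequency F.1

end LocalDim

/-! Upper bound: split the points into groups of size at most `t`. For a group `G` and a set `S ⊆
G`, stack `S` below all points whose set of incomparable elements in `G` is exactly `S`. For
incomparable `x`, `y`, taking `G ∋ x` puts `x` below `y`, and exchanging roles reverses the pair. A
point is an upper element at most once per group and a lower element only for subsets of its own
group, so one global linear extension and these stacks give frequency at most `1 + m + 2 ^ t`; take
`t` about half of `log₂ n`. Lower bound: a local realizer of frequency `d` is encoded by about `d *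
n * log n` bits (`exists_code`), while bipartite graphs yield `2 ^ (k * k)` posets with `k = n / 2`.
Hence `d` is at least of order `n / log n`. -/

namespace LocalDim

/-! ### Upper bound by grouping points -/

section Upper

variable {P : Type*} [PartialOrder P]

/-- The incomparable elements of `x` inside `G`. -/
def incompIn (G : Set P) (x : P) : Set P := {z | z ∈ G ∧ ¬ z ≤ x ∧ ¬ x ≤ z}

/-- A linear order on `A ∪ B` with `A` below `B`, when all elements of `A` are incomparable to all
elements of `B`. -/
theorem exists_ple_stack (A B : Set P) (hne : (A ∪ B).Nonempty)
    (h : ∀ a ∈ A, ∀ b ∈ B, ¬ a ≤ b ∧ ¬ b ≤ a) :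
    ∃ L : PartialLinearExtension P, L.carrier = A ∪ B ∧ ∀ a ∈ A, ∀ b ∈ B, L.lt a b := by
  obtain ⟨s, hs, hrs⟩ := extend_partialOrder (α := P) (· ≤ ·)
  have hanti : ∀ x y, s x y → s y x → x = y := fun x y => antisymm_of s
  have htrans : ∀ x y z, s x y → s y z → s x z := fun x y z => trans_of s
  have htot : ∀ x y, s x y ∨ s y x := total_of s
  have hle : ∀ x y : P, x ≤ y → s x y := hrs
  have hd : ∀ x, x ∈ A → x ∈ B → False := fun x hA hB => (h x hA x hB).1 le_rfl
  refine ⟨⟨A ∪ B, hne, fun x y => (x ∈ A ∧ y ∈ A ∧ s x y) ∨ (x ∈ B ∧ y ∈ B ∧ s x y) ∨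
    (x ∈ A ∧ y ∈ B), ?_, ?_, ?_, ?_, ?_⟩, rfl, ?_⟩
  · rintro x y (h | h | h) <;> simp [h.1, h.2]
  · rintro x y (⟨h1, h2, h3⟩ | ⟨h1, h2, h3⟩ | ⟨h1, h2⟩) (⟨k1, k2, k3⟩ | ⟨k1, k2, k3⟩ | ⟨k1, k2⟩) <;>
      first
      | exact hanti _ _ h3 k3
      | exact (hd x ‹_› ‹_›).elim
      | exact (hd y ‹_› ‹_›).elim
  · rintro x y z (⟨h1, h2, h3⟩ | ⟨h1, h2, h3⟩ | ⟨h1, h2⟩) (⟨k1, k2, k3⟩ | ⟨k1, k2, k3⟩ | ⟨k1, k2⟩) <;>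
      first
      | exact Or.inl ⟨h1, k2, htrans _ _ _ h3 k3⟩
      | exact Or.inr (Or.inl ⟨h1, k2, htrans _ _ _ h3 k3⟩)
      | exact Or.inr (Or.inr ⟨h1, k2⟩)
      | exact (hd y ‹_› ‹_›).elim
  · rintro x (hx | hx) y (hy | hy)
    · exact (htot x y).imp (fun k => Or.inl ⟨hx, hy, k⟩) (fun k => Or.inl ⟨hy, hx, k⟩)
    · exact Or.inl (Or.inr (Or.inr ⟨hx, hy⟩))
    · exact Or.inr (Or.inr (Or.inr ⟨hy, hx⟩))
    · exact (htot x y).imp (fun k => Or.inr (Or.inl ⟨hx, hy, k⟩))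
        (fun k => Or.inr (Or.inl ⟨hy, hx, k⟩))
  · rintro x (hx | hx) y (hy | hy) hxy
    · exact Or.inl ⟨hx, hy, hle _ _ hxy⟩
    · exact Or.inr (Or.inr ⟨hx, hy⟩)
    · exact ((h y hy x hx).2 hxy).elim
    · exact Or.inr (Or.inl ⟨hx, hy, hle _ _ hxy⟩)
  · exact fun a ha b hb => ⟨Or.inr (Or.inr ⟨ha, hb⟩), fun e => hd a ha (e ▸ hb)⟩

/-- There is a linear extension of the whole poset. -/
theorem exists_ple_univ [Nonempty P] :
    ∃ L : PartialLinearExtension P, ∀ x y, x < y → L.lt x y := by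
  obtain ⟨L, hL, -⟩ := exists_ple_stack (Set.univ : Set P) ∅ (by simp) (by simp)
  exact ⟨L, fun x y hxy => ⟨L.extends_le x (by simp [hL]) y (by simp [hL]) hxy.le, hxy.ne⟩⟩

/-- If the poset is partitioned into `m` groups of at most `t` elements, then its local dimension
is at most `1 + m + 2 ^ t`. -/
theorem localDim_le_of_partition [Nonempty P] {m t : ℕ} (g : P → Fin m)
    (hg : ∀ i, (g ⁻¹' {i}).encard ≤ t) : localDim P ≤ ((1 + m + 2 ^ t : ℕ) : ℕ∞) := by
  classical
  obtain ⟨L₀, hL₀⟩ := exists_ple_univ (P := P)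
  -- The guard makes the choice total: a set `S` that is nobody's incomparability set gets the dummy
  -- `L₀`.
  have hC : ∀ (i : Fin m) (S : Set P), ∃ L : PartialLinearExtension P,
      (∃ y, incompIn (g ⁻¹' {i}) y = S) →
        L.carrier = S ∪ {z | incompIn (g ⁻¹' {i}) z = S} ∧
        ∀ a ∈ S, ∀ b, incompIn (g ⁻¹' {i}) b = S → L.lt a b := by
    intro i S
    by_cases h : ∃ y, incompIn (g ⁻¹' {i}) y = S
    · obtain ⟨L, hL⟩ := exists_ple_stack S {z | incompIn (g ⁻¹' {i}) z = S}
        (by obtain ⟨y, hy⟩ := h; exact ⟨y, Or.inr hy⟩)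
        (by rintro a ha b rfl; exact ha.2)
      exact ⟨L, fun _ => hL⟩
    · exact ⟨L₀, fun h' => (h h').elim⟩
  choose C hC using hC
  set F : Set (PartialLinearExtension P) :=
    {L | L = L₀ ∨ ∃ i y, L = C i (incompIn (g ⁻¹' {i}) y)}
  have key : ∀ x y : P, ¬ x ≤ y → ¬ y ≤ x → ∃ L ∈ F, L.lt x y := fun x y h1 h2 =>
    ⟨C (g x) (incompIn (g ⁻¹' {g x}) y), Or.inr ⟨g x, y, rfl⟩,
      (hC (g x) _ ⟨y, rfl⟩).2 x ⟨rfl, h1, h2⟩ y rfl⟩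
  have hreal : IsLocalRealizer F :=
    ⟨⟨L₀, Or.inl rfl⟩, fun x y h => ⟨L₀, Or.inl rfl, hL₀ x y h⟩,
      fun x y h1 h2 => ⟨key x y h1 h2, key y x h2 h1⟩⟩
  refine (iInf_le _ (⟨F, hreal⟩ : {F : Set (PartialLinearExtension P) // IsLocalRealizer F})).trans
    (iSup_le fun x => ?_)
  -- As an upper element, `x` determines `S` from the group; as a lower element, it forces the group
  -- to be its own.
  have hsub : {L | L ∈ F ∧ x ∈ L.carrier} ⊆
      ({L₀} ∪ (fun i => C i (incompIn (g ⁻¹' {i}) x)) '' Set.univ) ∪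
        C (g x) '' (𝒫 (g ⁻¹' {g x})) := by
    rintro L ⟨rfl | ⟨i, y, rfl⟩, hx⟩
    · exact Or.inl (Or.inl rfl)
    · rw [(hC i _ ⟨y, rfl⟩).1] at hx
      rcases hx with hx | hx
      · obtain rfl : g x = i := hx.1
        exact Or.inr ⟨_, fun z hz => hz.1, rfl⟩
      · rw [← show incompIn (g ⁻¹' {i}) x = incompIn (g ⁻¹' {i}) y from hx]
        exact Or.inl (Or.inr ⟨i, trivial, rfl⟩)
  have hpow : (𝒫 (g ⁻¹' {g x})).encard ≤ ((2 ^ t : ℕ) : ℕ∞) := by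
    have hfin : (g ⁻¹' {g x}).Finite := Set.finite_of_encard_le_coe (hg _)
    have h1 := hg (g x)
    rw [← hfin.cast_ncard_eq, Nat.cast_le] at h1
    rw [← (hfin.powerset).cast_ncard_eq, Nat.cast_le, Set.ncard_powerset _ hfin]
    exact Nat.pow_le_pow_right (by norm_num) h1
  calc frequency x F ≤ _ := Set.encard_le_encard hsub
    _ ≤ _ := Set.encard_union_le _ _
    _ ≤ (1 + m) + ((2 ^ t : ℕ) : ℕ∞) := by
      refine add_le_add ((Set.encard_union_le _ _).trans (add_le_add ?_ ?_)) ?_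
      · simp
      · exact (Set.encard_image_le _ _).trans (by simp)
      · exact (Set.encard_image_le _ _).trans hpow
    _ = ((1 + m + 2 ^ t : ℕ) : ℕ∞) := by push_cast; rfl

theorem localDim_fin_le {n t : ℕ} (hn : 1 ≤ n) (ht : 1 ≤ t) (inst : PartialOrder (Fin n)) :
    @localDim (Fin n) inst ≤ ((n / t + 2 + 2 ^ t : ℕ) : ℕ∞) := by
  have : Nonempty (Fin n) := ⟨⟨0, hn⟩⟩
  have := localDim_le_of_partition (P := Fin n) (m := n / t + 1) (t := t)
    (fun x => ⟨x / t, Nat.lt_succ_of_le (Nat.div_le_div_right x.2.le)⟩) (by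
      intro i
      have hinj : Set.InjOn (fun x : Fin n => (⟨x % t, Nat.mod_lt _ ht⟩ : Fin t))
          ((fun x : Fin n => (⟨x / t, Nat.lt_succ_of_le (Nat.div_le_div_right x.2.le)⟩ :
            Fin (n / t + 1))) ⁻¹' {i}) := by
        intro x hx y hy hxy
        simp only [Set.mem_preimage, Set.mem_singleton_iff, Fin.ext_iff] at hx hy hxy
        ext
        rw [← Nat.div_add_mod x t, ← Nat.div_add_mod y t, hx, hy, hxy]
      rw [← hinj.encard_image]
      exact (Set.encard_le_encard (Set.subset_univ _)).trans (by simp))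
  convert this using 2
  omega

end Upper

/-! ### Lower bound by counting codes -/

section Lower

theorem exists_option_enum {α : Type*} {s : Set α} {d : ℕ} (h : s.encard ≤ d) :
    ∃ e : Fin d → Option α, ∀ a, a ∈ s ↔ ∃ i, e i = some a := by
  classical
  have hfin : s.Finite := Set.finite_of_encard_le_coe h
  rw [← hfin.cast_ncard_eq, Nat.cast_le] at h
  obtain ⟨l, hl⟩ : ∃ l : List α, l.length ≤ d ∧ ∀ a, a ∈ s ↔ a ∈ l := by
    refine ⟨hfin.toFinset.toList, ?_, by simp⟩
    rwa [Finset.length_toList, ← Set.ncard_eq_toFinset_card s hfin]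
  refine ⟨fun i => l[(i : ℕ)]?, fun a => ?_⟩
  rw [hl.2, List.mem_iff_getElem?]
  constructor
  · rintro ⟨i, hi⟩
    exact ⟨⟨i, (List.getElem?_eq_some_iff.1 hi).1.trans_le hl.1⟩, hi⟩
  · rintro ⟨i, hi⟩
    exact ⟨i, hi⟩

theorem exists_isLocalRealizer_of_localDim_le {P : Type*} [PartialOrder P] {d : ℕ}
    (h : localDim P ≤ d) :
    ∃ F : Set (PartialLinearExtension P), IsLocalRealizer F ∧ ∀ x, frequency x F ≤ d := by
  by_contra! hcon
  have : ((d : ℕ∞) + 1) ≤ localDim P := by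
    refine le_iInf fun F => ?_
    obtain ⟨x, hx⟩ := hcon F.1 F.2
    exact (Order.add_one_le_of_lt hx).trans (le_iSup (fun x => frequency x F.1) x)
  exact absurd (this.trans h) (by exact_mod_cast Nat.not_succ_le_self d)

/-- Incomparable pairs appear in both orders, comparable ones in only one, so a realizer determines
the poset. -/
theorem IsLocalRealizer.le_iff {P : Type*} [PartialOrder P] {F : Set (PartialLinearExtension P)}
    (hF : IsLocalRealizer F) (x y : P) :
    x ≤ y ↔ x = y ∨ (x ≠ y ∧ (∃ L ∈ F, L.le x y) ∧ ¬ ∃ L ∈ F, L.le y x) := by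
  constructor
  · intro h
    by_cases hxy : x = y
    · exact Or.inl hxy
    · obtain ⟨L, hL, hlt⟩ := hF.exists_of_lt x y (lt_of_le_of_ne h hxy)
      refine Or.inr ⟨hxy, ⟨L, hL, hlt.1⟩, ?_⟩
      rintro ⟨L', -, hle⟩
      obtain ⟨hy, hx⟩ := L'.mem_of_le _ _ hle
      exact hxy (L'.antisymm _ _ (L'.extends_le x hx y hy h) hle)
  · rintro (rfl | ⟨hne, -, hno⟩)
    · exact le_rfl
    · by_contra hxy
      by_cases hyx : y ≤ x
      · obtain ⟨L, hL, hlt⟩ := hF.exists_of_lt y x (lt_of_le_of_ne hyx hne.symm)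
        exact hno ⟨L, hL, hlt.1⟩
      · obtain ⟨L, hL, hlt⟩ := (hF.exists_of_incomp x y hxy hyx).2
        exact hno ⟨L, hL, hlt.1⟩

/-- A partial linear extension is determined on its ground set by the positions of its elements. -/
theorem PartialLinearExtension.exists_rank {n : ℕ} [PartialOrder (Fin n)]
    (L : PartialLinearExtension (Fin n)) :
    ∃ r : Fin n → Fin n, ∀ x ∈ L.carrier, ∀ y ∈ L.carrier, L.le x y ↔ r x ≤ r y := by
  classical
  have hlt : ∀ x, (Finset.univ.filter fun z => L.lt z x).card < n := fun x => by
    have : (Finset.univ.filter fun z => L.lt z x) ⊂ Finset.univ :=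
      (Finset.ssubset_univ_iff).2 fun h => by
        have := Finset.mem_univ x
        rw [← h] at this
        exact (Finset.mem_filter.1 this).2.2 rfl
    simpa using Finset.card_lt_card this
  have hmono : ∀ x y, L.le x y → (Finset.univ.filter fun z => L.lt z x) ⊆
      Finset.univ.filter fun z => L.lt z y := by
    intro x y h z hz
    simp only [Finset.mem_filter, Finset.mem_univ, true_and] at hz ⊢
    refine ⟨L.trans _ _ _ hz.1 h, ?_⟩
    rintro rfl
    exact hz.2 (L.antisymm _ _ hz.1 h)
  refine ⟨fun x => ⟨_, hlt x⟩, fun x hx y hy => ⟨fun h => Finset.card_le_card (hmono x y h), ?_⟩⟩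
  intro h
  by_contra hxy
  have hyx : L.le y x := (L.total x hx y hy).resolve_left hxy
  have hne : y ≠ x := by rintro rfl; exact hxy hyx
  refine absurd h (not_le.2 (Finset.card_lt_card ⟨hmono y x hyx, fun hs => ?_⟩))
  have : y ∈ Finset.univ.filter fun z => L.lt z y := hs (by simpa using ⟨hyx, hne⟩)
  exact (Finset.mem_filter.1 this).2.2 rfl

/-- Records, for each element, the partial linear extensions containing it and its positions. -/
abbrev Code (n d : ℕ) : Type := Fin n → Fin d → Option ((Fin n × Fin d) × Fin n)

/-- `x` is below `y` in some partial linear extension of the code. -/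
def Code.Below {n d : ℕ} (c : Code n d) (x y : Fin n) : Prop :=
  ∃ i j l p q, c x i = some (l, p) ∧ c y j = some (l, q) ∧ p ≤ q

theorem exists_code {n d : ℕ} (inst : PartialOrder (Fin n)) (h : @localDim (Fin n) inst ≤ d) :
    ∃ c : Code n d, ∀ x y, inst.le x y ↔
      x = y ∨ (x ≠ y ∧ c.Below x y ∧ ¬ c.Below y x) := by
  obtain ⟨F, hF, hfreq⟩ := exists_isLocalRealizer_of_localDim_le h
  choose e he using fun x => exists_option_enum (hfreq x)
  choose r hr using fun L : PartialLinearExtension (Fin n) => L.exists_rank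
  -- A member of `F` is named by one of its points and the slot it occupies there, so `n * d` names
  -- suffice; outside `F` the name is arbitrary.
  have hname : ∀ L : PartialLinearExtension (Fin n), ∃ l : Fin n × Fin d,
      L ∈ F → e l.1 l.2 = some L := by
    intro L
    obtain ⟨x, hx⟩ := L.nonempty
    by_cases hL : L ∈ F
    · obtain ⟨i, hi⟩ := (he x L).1 ⟨hL, hx⟩
      exact ⟨(x, i), fun _ => hi⟩
    · obtain ⟨L', hL'⟩ := hF.nonempty
      obtain ⟨x', hx'⟩ := L'.nonempty
      obtain ⟨i, -⟩ := (he x' L').1 ⟨hL', hx'⟩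
      exact ⟨(x, i), fun h' => (hL h').elim⟩
  choose name hname using hname
  refine ⟨fun x i => (e x i).map fun L => (name L, r L x), ?_⟩
  have key : ∀ x y, (∃ L ∈ F, L.le x y) ↔
      Code.Below (fun x i => (e x i).map fun L => (name L, r L x)) x y := by
    intro x y
    constructor
    · rintro ⟨L, hL, hle⟩
      obtain ⟨hx, hy⟩ := L.mem_of_le _ _ hle
      obtain ⟨i, hi⟩ := (he x L).1 ⟨hL, hx⟩
      obtain ⟨j, hj⟩ := (he y L).1 ⟨hL, hy⟩
      exact ⟨i, j, name L, r L x, r L y, by simp [hi], by simp [hj], (hr L x hx y hy).1 hle⟩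
    · rintro ⟨i, j, l, p, q, hx, hy, hpq⟩
      simp only [Option.map_eq_some_iff, Prod.mk.injEq] at hx hy
      obtain ⟨L, hL, rfl, rfl⟩ := hx
      obtain ⟨L', hL', hl, rfl⟩ := hy
      have hLx := (he x L).2 ⟨i, hL⟩
      have hLy := (he y L').2 ⟨j, hL'⟩
      obtain rfl : L' = L := by
        have h1 := hname L hLx.1
        rw [← hl, hname L' hLy.1] at h1
        exact Option.some.inj h1
      exact ⟨L', hLx.1, (hr L' x hLx.2 y hLy.2).2 hpq⟩
  intro x y
  rw [← key, ← key]
  exact hF.le_iff x y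

/-- The poset of height at most two on `Fin n` given by a bipartite graph between its first `k` and
its next `k` elements. -/
abbrev bipartiteOrder {n k : ℕ} (R : Fin k → Fin k → Bool) : PartialOrder (Fin n) where
  le x y := x = y ∨ ∃ i j : Fin k, (x : ℕ) = i ∧ (y : ℕ) = k + j ∧ R i j = true
  lt x y := (x = y ∨ ∃ i j : Fin k, (x : ℕ) = i ∧ (y : ℕ) = k + j ∧ R i j = true) ∧
    ¬ (y = x ∨ ∃ i j : Fin k, (y : ℕ) = i ∧ (x : ℕ) = k + j ∧ R i j = true)
  lt_iff_le_not_ge _ _ := Iff.rfl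
  le_refl x := Or.inl rfl
  le_trans := by
    rintro x y z (rfl | ⟨i, j, hx, hy, hR⟩) (rfl | ⟨i', j', hy', hz, hR'⟩)
    · exact Or.inl rfl
    · exact Or.inr ⟨i', j', hy', hz, hR'⟩
    · exact Or.inr ⟨i, j, hx, hy, hR⟩
    · have := i'.2
      omega
  le_antisymm := by
    rintro x y (rfl | ⟨i, j, hx, hy, hR⟩) (h | ⟨i', j', hy', hz, hR'⟩)
    · rfl
    · rfl
    · exact h.symm
    · have := i'.2
      omega

theorem bipartiteOrder_le_iff {n k : ℕ} (R : Fin k → Fin k → Bool) (hk : k + k ≤ n) (i j : Fin k) :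
    (bipartiteOrder (n := n) R).le ⟨i, by omega⟩ ⟨k + j, by omega⟩ ↔ R i j = true := by
  constructor
  · rintro (h | ⟨i', j', hi, hj, hR⟩)
    · have := Fin.ext_iff.1 h
      have := i.2
      simp only at *
      omega
    · obtain rfl : i = i' := Fin.ext hi
      obtain rfl : j = j' := Fin.ext (by simpa using hj)
      exact hR
  · exact fun h => Or.inr ⟨i, j, rfl, rfl, h⟩

theorem two_pow_le_of_localDim_le {n d k : ℕ} (hk : k + k ≤ n)
    (h : ∀ inst : PartialOrder (Fin n), @localDim (Fin n) inst ≤ d) :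
    2 ^ (k * k) ≤ (n * d * n + 1) ^ (d * n) := by
  choose c hc using fun R : Fin k → Fin k → Bool => exists_code (bipartiteOrder R) (h _)
  have hinj : Function.Injective c := by
    intro R R' hRR
    funext i j
    have h1 := bipartiteOrder_le_iff R hk i j
    have h2 := bipartiteOrder_le_iff R' hk i j
    rw [hc, hRR, ← hc, h2] at h1
    exact (Bool.eq_iff_iff.2 h1).symm
  have := Fintype.card_le_of_injective c hinj
  simpa [← pow_mul] using this

end Lower

/-! ### The extremal function and its asymptotics -/

section Max

/-- The maximum local dimension of a poset on `n` points. -/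
noncomputable def maxLocalDim (n : ℕ) : ℕ :=
  (sSup {d : ℕ∞ | ∃ inst : PartialOrder (Fin n), @localDim (Fin n) inst = d}).toNat

theorem isGreatest_maxLocalDim {n : ℕ} (hn : 1 ≤ n) :
    IsGreatest {d : ℕ∞ | ∃ inst : PartialOrder (Fin n), @localDim (Fin n) inst = d}
      (maxLocalDim n : ℕ∞) := by
  set S := {d : ℕ∞ | ∃ inst : PartialOrder (Fin n), @localDim (Fin n) inst = d}
  -- Any finite bound will do: it ensures that `toNat` loses nothing.
  have hbd : ∀ d ∈ S, d ≤ ((n / 1 + 2 + 2 ^ 1 : ℕ) : ℕ∞) := by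
    rintro d ⟨inst, rfl⟩
    exact localDim_fin_le hn le_rfl inst
  have hne : S.Nonempty := ⟨_, inferInstance, rfl⟩
  have hfin : S.Finite := by
    have : Finite (PartialOrder (Fin n)) :=
      Finite.of_injective (fun inst : PartialOrder (Fin n) => inst.le)
        fun a b hab => PartialOrder.ext fun x y => iff_of_eq (congrFun (congrFun hab x) y)
    exact Set.finite_range fun inst : PartialOrder (Fin n) => @localDim (Fin n) inst
  have hmem : sSup S ∈ S := hne.csSup_mem hfin
  have htop : sSup S ≠ ⊤ := fun h => by
    have := hbd _ hmem
    rw [h] at this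
    exact ENat.natCast_ne_top _ (top_le_iff.1 this)
  have hcast : ((maxLocalDim n : ℕ) : ℕ∞) = sSup S := ENat.natCast_toNat htop
  rw [hcast]
  exact ⟨hmem, fun d hd => le_sSup hd⟩

theorem maxLocalDim_le {n t : ℕ} (hn : 1 ≤ n) (ht : 1 ≤ t) :
    maxLocalDim n ≤ n / t + 2 + 2 ^ t := by
  obtain ⟨inst, h⟩ := (isGreatest_maxLocalDim hn).1
  have := localDim_fin_le hn ht inst
  rw [h] at this
  exact_mod_cast this

theorem two_pow_le_maxLocalDim {n k : ℕ} (hn : 1 ≤ n) (hk : k + k ≤ n) :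
    2 ^ (k * k) ≤ (n * maxLocalDim n * n + 1) ^ (maxLocalDim n * n) :=
  two_pow_le_of_localDim_le hk fun inst => (isGreatest_maxLocalDim hn).2 ⟨inst, rfl⟩

/-- The constant is `9 * 3`: `n / 2 ≥ n / 3` as reals, squared, and the code base is at most `n ^ 3`
when `d < n`. -/
theorem maxLocalDim_lower {n : ℕ} (hn : 3 ≤ n) :
    (n : ℝ) / Real.log n ≤ 27 / Real.log 2 * maxLocalDim n := by
  have hn0 : (3 : ℝ) ≤ n := by exact_mod_cast hn
  have hl2 : 0 < Real.log 2 := Real.log_pos (by norm_num)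
  have hl2' : Real.log 2 < 1 := by linarith [Real.log_two_lt_d9]
  have hlog : 1 ≤ Real.log n := by
    rw [Real.le_log_iff_exp_le (by linarith)]
    linarith [Real.exp_one_lt_d9]
  set d := maxLocalDim n with hd
  rw [div_mul_eq_mul_div, div_le_div_iff₀ (by linarith) hl2]
  rcases le_or_gt n d with hnd | hnd
  · have hnd' : (n : ℝ) ≤ d := by exact_mod_cast hnd
    nlinarith [mul_nonneg (by linarith : (0 : ℝ) ≤ d) (sub_nonneg.2 hlog)]
  · have hpow := two_pow_le_maxLocalDim (n := n) (k := n / 2) (by omega) (by omega)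
    rw [← hd] at hpow
    have hbase : n * d * n + 1 ≤ n ^ 3 := by
      have : n * n * (d + 1) ≤ n * n * n := Nat.mul_le_mul_left _ hnd
      nlinarith
    have hpow2 : (2 : ℝ) ^ (n / 2 * (n / 2)) ≤ ((n : ℝ) ^ 3) ^ (d * n) := by
      exact_mod_cast hpow.trans (Nat.pow_le_pow_left hbase _)
    have hlogs := Real.log_le_log (by positivity) hpow2
    rw [Real.log_pow, Real.log_pow, Real.log_pow] at hlogs
    push_cast at hlogs
    have hhalf : (n : ℝ) ≤ 3 * ((n / 2 : ℕ) : ℝ) := by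
      exact_mod_cast (by omega : n ≤ 3 * (n / 2))
    have hsq : (n : ℝ) * n ≤ 9 * (((n / 2 : ℕ) : ℝ) * ((n / 2 : ℕ) : ℝ)) := by nlinarith
    have h3 : (n : ℝ) * n * Real.log 2 ≤ 27 * d * n * Real.log n := by
      nlinarith [mul_le_mul_of_nonneg_right hsq hl2.le]
    have hnpos : (0 : ℝ) < n := by linarith
    refine le_of_mul_le_mul_left ?_ hnpos
    linarith

theorem eventually_logb_le_sqrt :
    ∀ᶠ n : ℕ in atTop, Real.logb 2 (2 * n) ≤ √(n : ℝ) / 2 := by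
  have h := (isLittleO_log_rpow_atTop (r := 1 / 2) (by norm_num)).def
    (c := Real.log 2 / 4) (by have := Real.log_pos (x := 2) (by norm_num); positivity)
  filter_upwards [tendsto_natCast_atTop_atTop.eventually h, eventually_ge_atTop 16] with n hn hn16
  have hn' : (16 : ℝ) ≤ n := by exact_mod_cast hn16
  have hl2 : 0 < Real.log 2 := Real.log_pos (by norm_num)
  rw [← Real.sqrt_eq_rpow, Real.norm_of_nonneg (Real.log_nonneg (by linarith)),
    Real.norm_of_nonneg (Real.sqrt_nonneg _)] at hn
  have h4 : 4 ≤ √(n : ℝ) := Real.le_sqrt_of_sq_le (by linarith)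
  rw [Real.logb, Real.log_mul (by norm_num) (by linarith), div_le_iff₀ hl2]
  nlinarith

theorem eventually_maxLocalDim_le :
    ∀ᶠ n : ℕ in atTop, (maxLocalDim n : ℝ) ≤ 4 * n / Real.logb 2 (2 * n) := by
  filter_upwards [eventually_logb_le_sqrt, eventually_ge_atTop 256] with n hlog hn
  have hn' : (256 : ℝ) ≤ n := by exact_mod_cast hn
  -- This makes `2 ^ t ≤ √n` negligible, while `n / t` is about `2 * n / log₂ n`, leaving slack
  -- below the constant 4.
  set t := Nat.log 2 n / 2 with ht
  have h8 : 8 ≤ Nat.log 2 n := Nat.le_log_of_pow_le (by norm_num) (by simpa using hn)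
  have hf := maxLocalDim_le (n := n) (t := t) (by omega) (by omega)
  have hpow : (2 ^ t) ^ 2 ≤ n := by
    rw [← pow_mul]
    exact (Nat.pow_le_pow_right (by norm_num) (by omega)).trans (Nat.pow_log_le_self 2 (by omega))
  have hsqrt : ((2 ^ t : ℕ) : ℝ) ≤ √(n : ℝ) := Real.le_sqrt_of_sq_le (by exact_mod_cast hpow)
  have h16 : 16 ≤ √(n : ℝ) := Real.le_sqrt_of_sq_le (by linarith)
  have hss : √(n : ℝ) * √(n : ℝ) = n := Real.mul_self_sqrt (by linarith)
  have hL : Real.logb 2 (2 * n) = 1 + Real.logb 2 n := by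
    rw [Real.logb_mul (by norm_num) (by linarith), Real.logb_self_eq_one (by norm_num)]
  have hup : Real.logb 2 n ≤ Nat.log 2 n + 1 := by
    rw [Real.logb_le_iff_le_rpow (by norm_num) (by linarith)]
    exact_mod_cast (Nat.lt_pow_succ_log_self (by norm_num) n).le
  have hlow : 8 ≤ Real.logb 2 n := by
    rw [Real.le_logb_iff_rpow_le (by norm_num) (by linarith)]
    norm_num
    linarith
  have htl : (Nat.log 2 n : ℝ) ≤ 2 * t + 1 := by exact_mod_cast (by omega : Nat.log 2 n ≤ 2 * t + 1)
  have hf' : (maxLocalDim n : ℝ) ≤ n / t + 2 + √(n : ℝ) := by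
    have h1 : (maxLocalDim n : ℝ) ≤ ((n / t : ℕ) : ℝ) + 2 + ((2 ^ t : ℕ) : ℝ) := by
      exact_mod_cast hf
    linarith [Nat.cast_div_le (α := ℝ) (m := n) (n := t)]
  set B := Real.logb 2 (2 * n) with hB
  have hBpos : 0 < B := by linarith
  have htpos : (0 : ℝ) < t := by linarith
  -- The roundings give `B ≤ 2 * t + 3`, which is at most `3 * t` since `t ≥ 4`.
  have e1 : (n : ℝ) / t ≤ 3 * n / B := by
    rw [div_le_div_iff₀ htpos hBpos]
    nlinarith
  have e2 : 2 + √(n : ℝ) ≤ n / B := by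
    rw [le_div_iff₀ hBpos]
    nlinarith
  have e3 : 4 * (n : ℝ) / B = 3 * n / B + n / B := by ring
  linarith

end Max

end LocalDim

theorem theorem1 :
    ∃ f : ℕ → ℕ,
      -- `f n` is the maximum local dimension of a poset on `n` points
      (∀ n : ℕ, 1 ≤ n →
        IsGreatest {d : ℕ∞ | ∃ inst : PartialOrder (Fin n), @LocalDim.localDim (Fin n) inst = d}
          (f n : ℕ∞)) ∧
      ((fun n : ℕ => (f n : ℝ)) =Θ[atTop] fun n : ℕ => (n : ℝ) / Real.log n) ∧
      (∃ ε : ℕ → ℝ, Tendsto ε atTop (𝓝 0) ∧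
        ∀ n : ℕ, 1 ≤ n → (f n : ℝ) ≤ (1 + ε n) * (4 * n / Real.logb 2 (2 * n))) := by
  refine ⟨LocalDim.maxLocalDim, fun n hn => LocalDim.isGreatest_maxLocalDim hn, ⟨?_, ?_⟩, ?_⟩
  · refine IsBigO.of_bound (4 * Real.log 2) ?_
    filter_upwards [LocalDim.eventually_maxLocalDim_le, eventually_ge_atTop 3] with n h hn
    have hn' : (3 : ℝ) ≤ n := by exact_mod_cast hn
    have hl2 : 0 < Real.log 2 := Real.log_pos (by norm_num)
    have hlog : 0 < Real.log n := Real.log_pos (by linarith)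
    rw [Real.norm_of_nonneg (by positivity), Real.norm_of_nonneg (by positivity)]
    refine h.trans ?_
    rw [Real.logb, Real.log_mul (by norm_num) (by linarith), div_div_eq_mul_div, mul_div_assoc',
      div_le_div_iff₀ (by linarith) hlog]
    have : 0 ≤ (n : ℝ) * Real.log 2 * Real.log 2 := by positivity
    nlinarith
  · refine IsBigO.of_bound (27 / Real.log 2) ?_
    filter_upwards [eventually_ge_atTop 3] with n hn
    have hn' : (3 : ℝ) ≤ n := by exact_mod_cast hn
    have hlog : 0 < Real.log n := Real.log_pos (by linarith)
    rw [Real.norm_of_nonneg (by positivity), Real.norm_of_nonneg (by positivity)]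
    exact LocalDim.maxLocalDim_lower hn
  -- The error is the relative excess over the bound: it covers small `n` and is eventually zero.
  · refine ⟨fun n => max 0 (LocalDim.maxLocalDim n / (4 * n / Real.logb 2 (2 * n)) - 1), ?_, ?_⟩
    · refine tendsto_const_nhds.congr' ?_
      filter_upwards [LocalDim.eventually_maxLocalDim_le, eventually_ge_atTop 1] with n h hn
      have hn' : (1 : ℝ) ≤ n := by exact_mod_cast hn
      have hB : 0 < Real.logb 2 (2 * n) := Real.logb_pos (by norm_num) (by linarith)
      refine (max_eq_left ?_).symm
      rw [sub_nonpos, div_le_one (by positivity)]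
      exact h
    · intro n hn
      have hn' : (1 : ℝ) ≤ n := by exact_mod_cast hn
      have hB : 0 < Real.logb 2 (2 * n) := Real.logb_pos (by norm_num) (by linarith)
      rw [← div_le_iff₀ (by positivity)]
      linarith [le_max_right 0 ((LocalDim.maxLocalDim n : ℝ) / (4 * n / Real.logb 2 (2 * n)) - 1)]
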